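/- **Setting.** All spaces are measurable spaces; $\mathcal GX$ is the space of subprobability measures on $X$, with the coarsest $\sigma$-algebra making all $\nu\mapsto\nu(A)$ measurable. For a relation $\Phi\subseteq X\times Y$, $\gamma\ge 1$ and $\delta\ge 0$, let $\mathcal G^{(\gamma,\delta)}\Phi$ be the set of pairs $(\nu_1,\nu_2)\in\mathcal GX\times\mathcal GY$ such that $\nu_1(A)\le\gamma\,\nu_2(B)+\delta$ for all measurable $A\subseteq X$, $B\subseteq Y$ with $\Phi(A)\subseteq B$, and let $\overline{\mathcal G^{(\gamma,\delta)}}\Phi=\mathcal G^{(\gamma,\delta)}\Phi\cap(\mathcal G^{(\gamma,\delta)}\Phi^{\mathrm{op}})^{\mathrm{op}}$. Commands of the language pWHILE are built from $\mathtt{skip}$, $\mathtt{null}$, sequencing, assignments $x\leftarrow e$, samplings $x\xleftarrow{\$}d(e_1,\dots,e_n)$, conditionals and while loops, over a finite typing context $\Gamma$ with value types $\mathtt{bool}$, $\mathtt{int}$, $\mathtt{real}$, $\mathtt{data}$ interpreted as the discrete spaces $\{\mathtt{true},\mathtt{false}\}$, $\mathbb Z$ and the Borel spaces $\mathbb R$,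 $\mathbb R^N$. Operations are measurable functions, probabilistic operations are measurable functions into $\mathcal G$, a memory is a point of the product space $[\![\Gamma]\!]$, and a command denotes a measurable map $[\![c]\!]\colon[\![\Gamma]\!]\to\mathcal G[\![\Gamma]\!]$ (Kleisli composition for sequencing, the supremum of the finite unfoldings for loops). A judgement $\models c_1\sim_{\gamma,\delta}c_2\colon\Psi\Rightarrow\Phi$ means that $([\![c_1]\!](m_1),[\![c_2]\!](m_2))\in\overline{\mathcal G^{(\gamma,\delta)}}\Phi$ whenever $(m_1,m_2)\in\Psi$; write $\models^{1}$ for the same with $\mathcal G^{(\gamma,\delta)}$ in place of $\overline{\mathcal G^{(\gamma,\delta)}}$. For $\sigma>0$, $\mathtt{Lap}_\sigma(a)$ is the probability measure on $\mathbb R$ with density proportional to $b\mapsto\exp(-|b-a|/\sigma)$. The notation $e\langle k\rangle$ means the value of $e$ in the $k$-th memory. **Algorithm.** Let $\varepsilon>0$, let $t\in\mathbb R$ be a threshold, $Q\in\mathbb Z$ (a code of) a set of $|Q|\in\mathbb N$ queries, and $\mathtt{eval}\colon\mathbb Z\times\mathbb Z\times\mathbb R^N\to\mathbb R$ a measurable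 function such that $\|d-d'\|_1\le 1$ implies $|\mathtt{eval}(Q,i,d)-\mathtt{eval}(Q,i,d')|\le 1$ for all $i\in\mathbb Z$. $\mathtt{AboveT}$ is the command over the context $j,r\colon\mathtt{int}$, $T,S\colon\mathtt{real}$, $d\colon\mathtt{data}$: $$\begin{array}{l} j\leftarrow 1;\ r\leftarrow |Q|+1;\ T\xleftarrow{\$}\mathtt{Lap}_{2/\varepsilon}(t);\\ \mathtt{while}\ j<|Q|\ \mathtt{do}\ \bigl(S\xleftarrow{\$}\mathtt{Lap}_{4/\varepsilon}(\mathtt{eval}(Q,j,d));\ \mathtt{if}\ T\le S\wedge r=|Q|+1\ \mathtt{then}\ r\leftarrow j;\ \ j\leftarrow j+1\bigr).\end{array}$$ **Theorem.** (1) $\mathtt{AboveT}$ is $(\varepsilon,0)$-differentially private: $$\models\mathtt{AboveT}\sim_{\exp(\varepsilon),0}\mathtt{AboveT}\colon\ \|d\langle1\rangle-d\langle2\rangle\|_1\le 1\ \Rightarrow\ r\langle1\rangle=r\langle2\rangle .$$ (2) The following rules are sound, for every finite context $\Gamma$ and every relation $\Psi$ on $[\![\Gamma]\!]$. * [Forall-Eq]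 Let $x\colon\mathtt{int}$ be a variable, $\gamma\ge1$, $\delta_i\ge 0$ and $\sum_{i\in\mathbb Z}\delta_i=\delta<\infty$. If $\models^{1}c_1\sim_{\gamma,\delta_i}c_2\colon\Psi\Rightarrow(x\langle1\rangle=i\Rightarrow x\langle2\rangle=i)$ for all $i\in\mathbb Z$, then $\models^{1}c_1\sim_{\gamma,\delta}c_2\colon\Psi\Rightarrow x\langle1\rangle=x\langle2\rangle$. If $\models c_1\sim_{\gamma,\delta_i}c_2\colon\Psi\Rightarrow(x\langle1\rangle=i\Rightarrow x\langle2\rangle=i)$ and $\models c_2\sim_{\gamma,\delta_i}c_1\colon\Psi^{\mathrm{op}}\Rightarrow(x\langle1\rangle=i\Rightarrow x\langle2\rangle=i)$ for all $i\in\mathbb Z$, then $\models c_1\sim_{\gamma,\delta}c_2\colon\Psi\Rightarrow x\langle1\rangle=x\langle2\rangle$. * [LapGen] Let $x,y$ be variables and $e_1,e_2$ expressions of type $\mathtt{real}$, $\sigma>0$ and $\rho,\rho'\in\mathbb R$. If $|[\![e_1]\!](m_1)+\rho'-[\![e_2]\!](m_2)|\le\rho$ for all $(m_1,m_2)\in\Psi$,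 then $\models x\xleftarrow{\$}\mathtt{Lap}_\sigma(e_1)\sim_{\exp(\rho/\sigma),0}y\xleftarrow{\$}\mathtt{Lap}_\sigma(e_2)\colon\Psi\Rightarrow x\langle1\rangle+\rho'=y\langle2\rangle$. * [LapNull] Let $x,y$ be variables and $e_1,e_2$ expressions of type $\mathtt{real}$ such that $x$ does not occur in $e_1$ and $y$ does not occur in $e_2$, and let $\sigma>0$. Then $\models x\xleftarrow{\$}\mathtt{Lap}_\sigma(e_1)\sim_{1,0}y\xleftarrow{\$}\mathtt{Lap}_\sigma(e_2)\colon\Psi\Rightarrow x\langle1\rangle-y\langle2\rangle=e_1\langle1\rangle-e_2\langle2\rangle$. -/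

import Mathlib

open MeasureTheory ProbabilityTheory
open scoped ENNReal

namespace ApRHL

noncomputable section

/-! ### The sub-Giry monad and stochastic relations -/

/-- The space of subprobability measures on `X`. As a subtype of `Measure X` it carries the coarsest
σ-algebra that makes every evaluation `ν ↦ ν A` (`A` measurable) measurable. -/
abbrev SubGiry (X : Type) [MeasurableSpace X] : Type := {ν : Measure X // ν Set.univ ≤ 1}

/-- Arrows `X → Y` of the Kleisli category of the sub-Giry monad: kernels all of whose measures are
subprobability measures. -/
abbrev SRel (X Y : Type) [MeasurableSpace X] [MeasurableSpace Y] : Type :=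
  {κ : Kernel X Y // ∀ x, κ x Set.univ ≤ 1}

namespace SRel

variable {X Y Z : Type} [MeasurableSpace X] [MeasurableSpace Y] [MeasurableSpace Z]

/-- The measurable function `X → 𝒢 Y` that underlies an arrow of `SRel`. -/
def toFun (f : SRel X Y) : X → SubGiry Y := fun x => ⟨f.1 x, f.2 x⟩

theorem measurable_toFun (f : SRel X Y) : Measurable f.toFun :=
  f.1.measurable.subtype_mk

instance instIsFiniteKernel (f : SRel X Y) : IsFiniteKernel f.1 :=
  ⟨1, ENNReal.one_lt_top, f.2⟩

/-- `η ∘ f` for a measurable function `f`. -/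
def pure (f : X → Y) (hf : Measurable f) : SRel X Y :=
  ⟨Kernel.deterministic f hf, fun _ => prob_le_one⟩

/-- The unit `η`. -/
def unit : SRel X X := pure (fun x => x) measurable_id

/-- The constant null measure. -/
def bot : SRel X Y := ⟨0, fun _ => by simp⟩

/-- Kleisli composition `g♯ ∘ f`. -/
def comp (g : SRel Y Z) (f : SRel X Y) : SRel X Z :=
  ⟨g.1 ∘ₖ f.1, fun x => by
    rw [Kernel.comp_apply' _ _ _ MeasurableSet.univ]
    calc ∫⁻ y, g.1 y Set.univ ∂(f.1 x) ≤ ∫⁻ _, 1 ∂(f.1 x) := lintegral_mono fun y => g.2 y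
      _ ≤ 1 := by simpa using f.2 x⟩

/-- Case distinction along a measurable Boolean. -/
def cond (b : X → Bool) (hb : Measurable b) (f g : SRel X Y) : SRel X Y :=
  ⟨{ toFun := fun x => if b x = true then f.1 x else g.1 x
     measurable' := Measurable.ite (hb (measurableSet_singleton true))
        f.1.measurable g.1.measurable }, fun x => by
    change (if b x = true then f.1 x else g.1 x) Set.univ ≤ 1
    split_ifs
    · exact f.2 x
    · exact g.2 x⟩

theorem cond_apply (b : X → Bool) (hb : Measurable b) (f g : SRel X Y) (x : X) :
    (cond b hb f g).1 x = if b x = true then f.1 x else g.1 x := rfl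

/-- The order of `SRel`: `f ⊑ g` iff `f x B ≤ g x B` for all `x` and all measurable `B`. -/
theorem le_iff (f g : SRel X Y) :
    f ≤ g ↔ ∀ x B, MeasurableSet B → f.1 x B ≤ g.1 x B := by
  change (∀ x, f.1 x ≤ g.1 x) ↔ _
  simp only [Measure.le_iff]

/-- The supremum of an ω-chain at a point: `B ↦ supₙ (fₙ x B)` on measurable sets. -/
def supMeasure (f : ℕ → SRel X Y) (hf : Monotone f) (x : X) : Measure Y :=
  Measure.ofMeasurable (fun B _ => ⨆ n, (f n).1 x B) (by simp) (fun s hs hd => by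
    simp only [measure_iUnion hd hs, ENNReal.tsum_eq_iSup_sum]
    rw [iSup_comm]
    refine iSup_congr fun t => Eq.symm ?_
    exact ENNReal.finsetSum_iSup_of_monotone (f := fun i n => (f n).1 x (s i))
      fun i _ _ h => (le_iff _ _).1 (hf h) x (s i) (hs i))

theorem supMeasure_apply (f : ℕ → SRel X Y) (hf : Monotone f) (x : X) {B : Set Y}
    (hB : MeasurableSet B) : supMeasure f hf x B = ⨆ n, (f n).1 x B :=
  Measure.ofMeasurable_apply B hB

/-- The supremum of an ω-chain. -/
def sup (f : ℕ → SRel X Y) (hf : Monotone f) : SRel X Y :=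
  ⟨{ toFun := supMeasure f hf
     measurable' := by
        refine Measure.measurable_of_measurable_coe _ fun B hB => ?_
        simp only [supMeasure_apply f hf _ hB]
        exact Measurable.iSup fun n => Kernel.measurable_coe _ hB },
   fun x => (supMeasure_apply f hf x MeasurableSet.univ).le.trans (iSup_le fun n => (f n).2 x)⟩

/-- The `n`-th approximation of a loop: `if b then null else skip` for `n = 0`, and
`if b then (c; approximation k) else skip` for `n = k + 1`. -/
def whileApprox (b : X → Bool) (hb : Measurable b) (c : SRel X X) : ℕ → SRel X X
  | 0 => cond b hb bot unit
  | k + 1 => cond b hb (comp (whileApprox b hb c k) c) unit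

theorem cond_le_cond (b : X → Bool) (hb : Measurable b) {f f' : SRel X Y} (g : SRel X Y)
    (h : f ≤ f') : cond b hb f g ≤ cond b hb f' g := by
  rw [le_iff] at h ⊢
  intro x B hB
  simp only [cond_apply]
  split_ifs
  · exact h x B hB
  · exact le_rfl

theorem comp_le_comp {f f' : SRel Y Z} (g : SRel X Y) (h : f ≤ f') : comp f g ≤ comp f' g := by
  rw [le_iff] at h ⊢
  intro x B hB
  simp only [comp, Kernel.comp_apply' _ _ _ hB]
  exact lintegral_mono fun y => h y B hB

theorem whileApprox_mono (b : X → Bool) (hb : Measurable b) (c : SRel X X) :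
    Monotone (whileApprox b hb c) := by
  refine monotone_nat_of_le_succ fun n => ?_
  induction n with
  | zero => exact cond_le_cond b hb _ ((le_iff _ _).2 fun x B _ => by simp [bot])
  | succ k ih => exact cond_le_cond b hb _ (comp_le_comp _ ih)

/-- The loop `while b do c`, as the supremum of its approximations. -/
def loop (b : X → Bool) (hb : Measurable b) (c : SRel X X) : SRel X X :=
  sup (whileApprox b hb c) (whileApprox_mono b hb c)

end SRel

/-! ### Relations between measurable spaces and the graded lifting -/

/-- `(f, g)` is an arrow `Φ → Φ'` of relations between measurable spaces. -/
def IsArrow {X Y X' Y' : Type} [MeasurableSpace X] [MeasurableSpace Y]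
    [MeasurableSpace X'] [MeasurableSpace Y']
    (Φ : X → Y → Prop) (Φ' : X' → Y' → Prop) (f : X → X') (g : Y → Y') : Prop :=
  Measurable f ∧ Measurable g ∧ ∀ x y, Φ x y → Φ' (f x) (g y)

/-- The image `Φ(A)` of a set under a relation. -/
def relImage {X Y : Type} (Φ : X → Y → Prop) (A : Set X) : Set Y := {y | ∃ x ∈ A, Φ x y}

/-- The one-sided lifting `𝒢^(γ,δ) Φ`. -/
def lift {X Y : Type} [MeasurableSpace X] [MeasurableSpace Y] (γ δ : ℝ) (Φ : X → Y → Prop) :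
    SubGiry X → SubGiry Y → Prop :=
  fun ν₁ ν₂ => ∀ (A : Set X) (B : Set Y), MeasurableSet A → MeasurableSet B →
    relImage Φ A ⊆ B → ν₁.1 A ≤ ENNReal.ofReal γ * ν₂.1 B + ENNReal.ofReal δ

/-- The symmetrised lifting: the intersection of `𝒢^(γ,δ) Φ` with the opposite of
`𝒢^(γ,δ)` applied to the opposite of `Φ`. -/
def symLift {X Y : Type} [MeasurableSpace X] [MeasurableSpace Y] (γ δ : ℝ) (Φ : X → Y → Prop) :
    SubGiry X → SubGiry Y → Prop :=
  fun ν₁ ν₂ => lift γ δ Φ ν₁ ν₂ ∧ lift γ δ (fun y x => Φ x y) ν₂ ν₁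

/-! ### The language pWHILE -/

/-- Value types. -/
inductive Ty : Type
  | bool
  | int
  | real
  | data (N : ℕ)

/-- The type of query sets is an alias of `int`. -/
abbrev Ty.queries : Ty := Ty.int

/-- The space interpreting a value type. -/
abbrev Ty.interp : Ty → Type
  | .bool => Bool
  | .int => ℤ
  | .real => ℝ
  | .data N => Fin N → ℝ

/-- `bool` and `int` are discrete; `real` and `data` carry the Borel σ-algebra. -/
instance Ty.instMeasurableSpace : (τ : Ty) → MeasurableSpace τ.interp
  | .bool => (inferInstance : MeasurableSpace Bool)
  | .int => (inferInstance : MeasurableSpace ℤ)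
  | .real => (inferInstance : MeasurableSpace ℝ)
  | .data N => (inferInstance : MeasurableSpace (Fin N → ℝ))

/-- Operations `(τ₁, …, τₙ) → τ`: measurable functions. -/
abbrev Op {n : ℕ} (σ : Fin n → Ty) (τ : Ty) : Type :=
  {p : ((i : Fin n) → (σ i).interp) → τ.interp // Measurable p}

/-- Probabilistic operations `(τ₁, …, τₙ) → τ`: measurable functions to subprobability measures. -/
abbrev POp {n : ℕ} (σ : Fin n → Ty) (τ : Ty) : Type :=
  SRel ((i : Fin n) → (σ i).interp) τ.interp

section Language

variable {V : Type}

/-- Memories of a typing context `Γ`, with the product σ-algebra. -/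
abbrev Mem (Γ : V → Ty) : Type := (x : V) → (Γ x).interp

/-- The variables of type `τ` in the context `Γ`. -/
abbrev Var (Γ : V → Ty) (τ : Ty) : Type := {x : V // Γ x = τ}

/-- Expressions `e ::= x | p(e₁, …, eₙ)`, well typed by construction. -/
inductive Expr (Γ : V → Ty) : Ty → Type
  | var {τ : Ty} (x : Var Γ τ) : Expr Γ τ
  | op {n : ℕ} {σ : Fin n → Ty} {τ : Ty} (p : Op σ τ) (args : (i : Fin n) → Expr Γ (σ i)) :
      Expr Γ τ

/-- Probabilistic expressions `d(e₁, …, eₙ)`. -/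
inductive PExpr (Γ : V → Ty) : Ty → Type
  | op {n : ℕ} {σ : Fin n → Ty} {τ : Ty} (d : POp σ τ) (args : (i : Fin n) → Expr Γ (σ i)) :
      PExpr Γ τ

mutual

/-- Imperatives. -/
inductive Imp (Γ : V → Ty) : Type
  | assign {τ : Ty} (x : Var Γ τ) (e : Expr Γ τ) : Imp Γ
  | sample {τ : Ty} (x : Var Γ τ) (ν : PExpr Γ τ) : Imp Γ
  | ite (b : Expr Γ Ty.bool) (c₁ c₂ : Cmd Γ) : Imp Γ
  | while (b : Expr Γ Ty.bool) (c : Cmd Γ) : Imp Γ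

/-- Commands `c ::= skip | null | i; c`. -/
inductive Cmd (Γ : V → Ty) : Type
  | skip : Cmd Γ
  | null : Cmd Γ
  | seq (i : Imp Γ) (c : Cmd Γ) : Cmd Γ

end

variable {Γ : V → Ty}

/-- An imperative regarded as a command. -/
def Imp.cmd (i : Imp Γ) : Cmd Γ := Cmd.seq i Cmd.skip

/-- The free variables of an expression. -/
def Expr.FV : {τ : Ty} → Expr Γ τ → Set V
  | _, .var x => {x.1}
  | _, .op _ args => ⋃ i, (args i).FV

/-! ### Denotational semantics -/

/-- The projection of a memory to a variable. -/
def Var.get {τ : Ty} (x : Var Γ τ) (m : Mem Γ) : τ.interp := x.2 ▸ m x.1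

theorem Var.measurable_get {τ : Ty} (x : Var Γ τ) : Measurable x.get := by
  obtain ⟨x, rfl⟩ := x
  exact measurable_pi_apply x

/-- Overwriting one variable of a memory. -/
def Var.set [DecidableEq V] {τ : Ty} (x : Var Γ τ) (p : τ.interp × Mem Γ) : Mem Γ :=
  Function.update p.2 x.1 (x.2.symm ▸ p.1)

theorem Var.measurable_set [DecidableEq V] {τ : Ty} (x : Var Γ τ) : Measurable x.set := by
  obtain ⟨x, rfl⟩ := x
  refine measurable_pi_lambda _ fun y => ?_
  by_cases h : y = x
  · subst h
    simpa [Var.set] using measurable_fst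
  · simpa [Var.set, Function.update_of_ne h, Function.comp_def] using
      (measurable_pi_apply (X := fun z => (Γ z).interp) y).comp
        (measurable_snd (α := (Γ x).interp) (β := Mem Γ))

/-- The interpretation of expressions. -/
def Expr.eval : {τ : Ty} → Expr Γ τ → Mem Γ → τ.interp
  | _, .var x, m => x.get m
  | _, .op p args, m => p.1 fun i => (args i).eval m

theorem Expr.measurable_eval {τ : Ty} (e : Expr Γ τ) : Measurable e.eval := by
  induction e with
  | var x => exact x.measurable_get
  | op p args ih => exact p.2.comp (measurable_pi_lambda _ fun i => ih i)

/-- The interpretation of probabilistic expressions. -/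
def PExpr.eval : {τ : Ty} → PExpr Γ τ → SRel (Mem Γ) τ.interp
  | _, .op d args => d.comp
      (SRel.pure (fun m i => (args i).eval m) (measurable_pi_lambda _ fun i => (args i).measurable_eval))

/-- The interpretation of `x ←$ ν`: the value of `ν` is drawn independently of the (Dirac
distributed) current memory, and then stored in `x`. -/
def SRel.draw [DecidableEq V] {τ : Ty} (x : Var Γ τ) (ν : SRel (Mem Γ) τ.interp) :
    SRel (Mem Γ) (Mem Γ) :=
  ⟨(ν.1 ×ₖ Kernel.id).map x.set, fun m => by
    rw [Kernel.map_apply' _ x.measurable_set _ MeasurableSet.univ, Kernel.prod_apply,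
      Kernel.id_apply, Set.preimage_univ, ← Set.univ_prod_univ, Measure.prod_prod,
      measure_univ (μ := Measure.dirac m), mul_one]
    exact ν.2 m⟩

mutual

/-- The interpretation of imperatives. -/
def Imp.interp [DecidableEq V] : Imp Γ → SRel (Mem Γ) (Mem Γ)
  | .assign x e => SRel.pure (fun m => x.set (e.eval m, m))
      (x.measurable_set.comp (e.measurable_eval.prodMk measurable_id))
  | .sample x ν => SRel.draw x ν.eval
  | .ite b c₁ c₂ => SRel.cond b.eval b.measurable_eval c₁.interp c₂.interp
  | .while b c => SRel.loop b.eval b.measurable_eval c.interp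

/-- The interpretation of commands. -/
def Cmd.interp [DecidableEq V] : Cmd Γ → SRel (Mem Γ) (Mem Γ)
  | .skip => SRel.unit
  | .null => SRel.bot
  | .seq i c => c.interp.comp i.interp

end

/-! ### Judgements -/

/-- Validity of the judgement `c₁ ∼_{γ,δ} c₂ : Ψ ⇒ Φ`. -/
def Valid [DecidableEq V] (c₁ c₂ : Cmd Γ) (γ δ : ℝ) (Ψ Φ : Mem Γ → Mem Γ → Prop) : Prop :=
  IsArrow Ψ (symLift γ δ Φ) c₁.interp.toFun c₂.interp.toFun

/-- One-sided validity, with the one-sided lifting in place of its symmetrisation. -/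
def OneSidedValid [DecidableEq V] (c₁ c₂ : Cmd Γ) (γ δ : ℝ) (Ψ Φ : Mem Γ → Mem Γ → Prop) : Prop :=
  IsArrow Ψ (lift γ δ Φ) c₁.interp.toFun c₂.interp.toFun

end Language

/-! ### The Laplacian mechanism -/

/-- The unnormalised density of the Laplacian mechanism with scale `s`, centred at `a`. -/
def lapDensity (s a b : ℝ) : ℝ≥0∞ := ENNReal.ofReal (2 / s * Real.exp (-|b - a| / s))

theorem measurable_lapDensity (s : ℝ) :
    Measurable (Function.uncurry (lapDensity s)) := by
  unfold lapDensity Function.uncurry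
  fun_prop

/-- The Laplacian mechanism `a ↦ f_a`, `f_a(B) = (∫_B f(a,·)) / (∫ f(a,·))`. -/
def lap (s : ℝ) : SRel ℝ ℝ :=
  ⟨{ toFun := fun a => (∫⁻ b, lapDensity s a b)⁻¹ • volume.withDensity (lapDensity s a)
     measurable' := by
        refine Measure.measurable_of_measurable_coe _ fun B hB => ?_
        simp only [Measure.smul_apply, withDensity_apply _ hB, smul_eq_mul]
        exact (Measurable.lintegral_prod_right (measurable_lapDensity s)).inv.mul
          (Measurable.lintegral_prod_right (measurable_lapDensity s)) },
   fun a => by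
     change ((∫⁻ b, lapDensity s a b)⁻¹ • volume.withDensity (lapDensity s a)) Set.univ ≤ 1
     simp only [Measure.smul_apply, withDensity_apply _ MeasurableSet.univ, smul_eq_mul,
       Measure.restrict_univ]
     rw [mul_comm, ← div_eq_mul_inv]
     exact ENNReal.div_self_le_one⟩

/-- The probabilistic operation `Lap_s : real → real`. -/
def lapOp (s : ℝ) : POp ![Ty.real] Ty.real :=
  (lap s).comp (SRel.pure (fun v => v 0) (measurable_pi_apply 0))

section Build

variable {V : Type} {Γ : V → Ty}

/-- The probabilistic expression `Lap_s(e)`. -/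
def PExpr.lap (s : ℝ) (e : Expr Γ Ty.real) : PExpr Γ Ty.real :=
  PExpr.op (lapOp s) (Fin.cons e finZeroElim)

/-- Constants are `0`-ary operations. -/
def Expr.const {τ : Ty} (a : τ.interp) : Expr Γ τ :=
  Expr.op (n := 0) (σ := ![]) ⟨fun _ => a, measurable_const⟩ finZeroElim

/-- Application of a binary operation. -/
def Expr.op₂ {τ₁ τ₂ τ : Ty} (p : τ₁.interp × τ₂.interp → τ.interp) (hp : Measurable p)
    (e₁ : Expr Γ τ₁) (e₂ : Expr Γ τ₂) : Expr Γ τ :=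
  Expr.op (n := 2) (σ := ![τ₁, τ₂])
    ⟨fun v => p (v 0, v 1), hp.comp ((measurable_pi_apply 0).prodMk (measurable_pi_apply 1))⟩
    (Fin.cons e₁ (Fin.cons e₂ finZeroElim))

/-- Application of a ternary operation. -/
def Expr.op₃ {τ₁ τ₂ τ₃ τ : Ty} (p : τ₁.interp × τ₂.interp × τ₃.interp → τ.interp)
    (hp : Measurable p) (e₁ : Expr Γ τ₁) (e₂ : Expr Γ τ₂) (e₃ : Expr Γ τ₃) : Expr Γ τ :=
  Expr.op (n := 3) (σ := ![τ₁, τ₂, τ₃])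
    ⟨fun v => p (v 0, v 1, v 2), hp.comp ((measurable_pi_apply 0).prodMk
      ((measurable_pi_apply 1).prodMk (measurable_pi_apply 2)))⟩
    (Fin.cons e₁ (Fin.cons e₂ (Fin.cons e₃ finZeroElim)))

/-- `e₁ + e₂` on `int`. -/
def Expr.add (e₁ e₂ : Expr Γ Ty.int) : Expr Γ Ty.int :=
  Expr.op₂ (τ₁ := .int) (τ₂ := .int) (τ := .int)
    (fun p : ℤ × ℤ => p.1 + p.2) (measurable_fst.add measurable_snd) e₁ e₂

/-- `e₁ < e₂` on `int`. -/
def Expr.ltInt (e₁ e₂ : Expr Γ Ty.int) : Expr Γ Ty.bool :=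
  Expr.op₂ (τ₁ := .int) (τ₂ := .int) (τ := .bool)
    (fun p : ℤ × ℤ => decide (p.1 < p.2)) (measurable_of_countable _) e₁ e₂

/-- `e₁ = e₂` on `int`. -/
def Expr.eqInt (e₁ e₂ : Expr Γ Ty.int) : Expr Γ Ty.bool :=
  Expr.op₂ (τ₁ := .int) (τ₂ := .int) (τ := .bool)
    (fun p : ℤ × ℤ => decide (p.1 = p.2)) (measurable_of_countable _) e₁ e₂

theorem measurable_decide_le : Measurable fun p : ℝ × ℝ => decide (p.1 ≤ p.2) :=
  measurable_to_bool (by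
    simpa [Set.preimage] using measurableSet_le (measurable_fst (α := ℝ) (β := ℝ)) measurable_snd)

/-- `e₁ ≤ e₂` on `real`. -/
def Expr.leReal (e₁ e₂ : Expr Γ Ty.real) : Expr Γ Ty.bool :=
  Expr.op₂ (τ₁ := .real) (τ₂ := .real) (τ := .bool)
    (fun p : ℝ × ℝ => decide (p.1 ≤ p.2)) measurable_decide_le e₁ e₂

/-- Conjunction. -/
def Expr.and (e₁ e₂ : Expr Γ Ty.bool) : Expr Γ Ty.bool :=
  Expr.op₂ (τ₁ := .bool) (τ₂ := .bool) (τ := .bool)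
    (fun p : Bool × Bool => p.1 && p.2) (measurable_of_countable _) e₁ e₂

end Build

/-! ### The above-threshold algorithm -/

namespace Above

/-- The program variables of the above-threshold algorithm. -/
inductive Name : Type
  | j
  | r
  | T
  | S
  | d
  deriving DecidableEq

/-- Its typing context. -/
abbrev ctx (N : ℕ) : Name → Ty
  | .j => .int
  | .r => .int
  | .T => .real
  | .S => .real
  | .d => .data N

variable {N : ℕ}

def j : Var (ctx N) Ty.int := ⟨.j, rfl⟩
def r : Var (ctx N) Ty.int := ⟨.r, rfl⟩
def T : Var (ctx N) Ty.real := ⟨.T, rfl⟩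
def S : Var (ctx N) Ty.real := ⟨.S, rfl⟩
def d : Var (ctx N) (Ty.data N) := ⟨.d, rfl⟩

/-- The body of the main loop:
`S ←$ Lap_{4/ε}(eval(Q, j, d)); if T ≤ S ∧ r = |Q| + 1 then r ← j; j ← j + 1`,
where `size` is the number `|Q|` of queries. -/
def body (ε : ℝ) (Q : ℤ) (size : ℕ) (evalQ : ℤ × ℤ × (Fin N → ℝ) → ℝ) (hevalQ : Measurable evalQ) :
    Cmd (ctx N) :=
  .seq (.sample S (.lap (4 / ε) (Expr.op₃ (τ₁ := .queries) (τ₂ := .int) (τ₃ := .data N)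
    (τ := .real) evalQ hevalQ (.const (τ := .queries) Q) (.var j) (.var d)))) <|
  .seq (.ite
    ((Expr.leReal (.var T) (.var S)).and
      (Expr.eqInt (.var r) (.add (.const (τ := .int) (size : ℤ)) (.const (τ := .int) (1 : ℤ)))))
    (.seq (.assign r (.var j)) .skip)
    .skip) <|
  .seq (.assign j (.add (.var j) (.const (τ := .int) (1 : ℤ)))) .skip

/-- The above-threshold algorithm:
`j ← 1; r ← |Q| + 1; T ←$ Lap_{2/ε}(t); while j < |Q| do body`. -/
def aboveT (ε t : ℝ) (Q : ℤ) (size : ℕ) (evalQ : ℤ × ℤ × (Fin N → ℝ) → ℝ)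
    (hevalQ : Measurable evalQ) : Cmd (ctx N) :=
  .seq (.assign j (.const (τ := .int) (1 : ℤ))) <|
  .seq (.assign r (.add (.const (τ := .int) (size : ℤ)) (.const (τ := .int) (1 : ℤ)))) <|
  .seq (.sample T (.lap (2 / ε) (.const (τ := .real) t))) <|
  .seq (.while (.ltInt (.var j) (.const (τ := .int) (size : ℤ)))
    (body ε Q size evalQ hevalQ)) .skip

end Above

/-! ### Soundness of the additional proof rules -/

/-- The rule [Forall-Eq] for one-sided validity. -/
def ForallEqOneSidedSound : Prop :=
  ∀ (V : Type) [Finite V] [DecidableEq V] (Γ : V → Ty) (c₁ c₂ : Cmd Γ) (x : Var Γ Ty.int)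
    (γ : ℝ) (δ : ℤ → ℝ) (δ' : ℝ) (Ψ : Mem Γ → Mem Γ → Prop),
    1 ≤ γ → (∀ i, 0 ≤ δ i) → HasSum δ δ' →
    (∀ i : ℤ, OneSidedValid c₁ c₂ γ (δ i) Ψ fun m₁ m₂ => x.get m₁ = i → x.get m₂ = i) →
    OneSidedValid c₁ c₂ γ δ' Ψ fun m₁ m₂ => x.get m₁ = x.get m₂

/-- The rule [Forall-Eq] for (two-sided) validity, with premises for both directions. -/
def ForallEqSound : Prop :=
  ∀ (V : Type) [Finite V] [DecidableEq V] (Γ : V → Ty) (c₁ c₂ : Cmd Γ) (x : Var Γ Ty.int)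
    (γ : ℝ) (δ : ℤ → ℝ) (δ' : ℝ) (Ψ : Mem Γ → Mem Γ → Prop),
    1 ≤ γ → (∀ i, 0 ≤ δ i) → HasSum δ δ' →
    (∀ i : ℤ, Valid c₁ c₂ γ (δ i) Ψ fun m₁ m₂ => x.get m₁ = i → x.get m₂ = i) →
    (∀ i : ℤ, Valid c₂ c₁ γ (δ i) (fun m₂ m₁ => Ψ m₁ m₂)
      fun m₂ m₁ => x.get m₂ = i → x.get m₁ = i) →
    Valid c₁ c₂ γ δ' Ψ fun m₁ m₂ => x.get m₁ = x.get m₂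

/-- The rule [LapGen]. -/
def LapGenSound : Prop :=
  ∀ (V : Type) [Finite V] [DecidableEq V] (Γ : V → Ty) (x y : Var Γ Ty.real)
    (e₁ e₂ : Expr Γ Ty.real) (s ρ ρ' : ℝ) (Ψ : Mem Γ → Mem Γ → Prop),
    0 < s → (∀ m₁ m₂, Ψ m₁ m₂ → |e₁.eval m₁ + ρ' - e₂.eval m₂| ≤ ρ) →
    Valid (Imp.sample x (.lap s e₁)).cmd (Imp.sample y (.lap s e₂)).cmd (Real.exp (ρ / s)) 0 Ψ
      fun m₁ m₂ => x.get m₁ + ρ' = y.get m₂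

/-- The rule [LapNull]. -/
def LapNullSound : Prop :=
  ∀ (V : Type) [Finite V] [DecidableEq V] (Γ : V → Ty) (x y : Var Γ Ty.real)
    (e₁ e₂ : Expr Γ Ty.real) (s : ℝ) (Ψ : Mem Γ → Mem Γ → Prop),
    0 < s → x.1 ∉ e₁.FV → y.1 ∉ e₂.FV →
    Valid (Imp.sample x (.lap s e₁)).cmd (Imp.sample y (.lap s e₂)).cmd 1 0 Ψ
      fun m₁ m₂ => x.get m₁ - y.get m₂ = e₁.eval m₁ - e₂.eval m₂

end

end ApRHL

/-!
The approximate lifting composes along the Kleisli composition: a bound on measures of sets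
extends to integrals of functions with values in `[0, 1]` by the layer-cake formula. Hence a loop
preserves an invariant that carries a privacy budget, provided that each round pays for itself out
of the budget. Translating Laplacian noise by a constant multiplies its density by a bounded factor;
if the centre is translated along, this costs nothing.

For the above-threshold algorithm, fix a query `i` and bound the probability of the output `i`.
Couple the runs so that the threshold of the second is one above that of the first, at the price
`exp (ε / 2)`. In each round but the `i`-th, shift the noise by the difference of the two query
values, which is free: a run that does not report in the first memory does not report in the second
one either, since the shift is at most one. In round `i`, shift by exactly one, so that both runs
report or neither does; this costs the other `exp (ε / 2)`, and no later round matters for the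
output `i`. Finally, [Forall-Eq] sums over `i`; as all `δ i` are `0`, the number of queries does
not enter.
-/

namespace ApRHL

namespace SRel

variable {X Y Z : Type} [MeasurableSpace X] [MeasurableSpace Y] [MeasurableSpace Z]

theorem pure_apply (f : X → Y) (hf : Measurable f) (x : X) :
    (pure f hf).1 x = Measure.dirac (f x) :=
  Kernel.deterministic_apply hf x

theorem comp_apply_of_dirac (g : SRel Y Z) (f : SRel X Y) {x : X} {y : Y}
    (h : f.1 x = Measure.dirac y) : (g.comp f).1 x = g.1 y := by
  change (g.1 ∘ₖ f.1) x = g.1 y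
  rw [Kernel.comp_apply, h, Measure.dirac_bind g.1.measurable]

theorem unit_comp (f : SRel X Y) : unit.comp f = f :=
  Subtype.ext (Kernel.id_comp f.1)

theorem whileApprox_apply_of_false {b : X → Bool} (hb : Measurable b) (c : SRel X X) (n : ℕ)
    {x : X} (hx : b x = false) : (whileApprox b hb c n).1 x = Measure.dirac x := by
  cases n <;> simp [whileApprox, cond_apply, hx, unit, pure_apply]

end SRel

section Lifting

variable {X Y X' Y' : Type} [MeasurableSpace X] [MeasurableSpace Y] [MeasurableSpace X']
  [MeasurableSpace Y'] {γ γ' δ δ' : ℝ} {Φ : X → Y → Prop} {Φ' : X' → Y' → Prop}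
  {ν₁ : SubGiry X} {ν₂ : SubGiry Y}

theorem lift.map {μ₁ : SubGiry X} {μ₂ : SubGiry Y} (h : lift γ δ Φ μ₁ μ₂) {f : X → X'}
    {g : Y → Y'} (hf : Measurable f) (hg : Measurable g) {ν₁ : SubGiry X'} {ν₂ : SubGiry Y'}
    (hν₁ : ν₁.1 = μ₁.1.map f) (hν₂ : ν₂.1 = μ₂.1.map g)
    (hΦ : ∀ x y, Φ x y → Φ' (f x) (g y)) : lift γ δ Φ' ν₁ ν₂ := by
  intro A B hA hB hAB
  rw [hν₁, hν₂, Measure.map_apply hf hA, Measure.map_apply hg hB]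
  refine h _ _ (hf hA) (hg hB) ?_
  rintro y ⟨x, hx, hxy⟩
  exact hAB ⟨f x, hx, hΦ x y hxy⟩

theorem lift_of_dirac (hγ : 1 ≤ γ) {x : X} {y : Y} (hν₁ : ν₁.1 = Measure.dirac x)
    (hν₂ : ν₂.1 = Measure.dirac y) (hΦ : Φ x y) : lift γ δ Φ ν₁ ν₂ := by
  intro A B hA hB hAB
  rw [hν₁, hν₂, Measure.dirac_apply' _ hA, Measure.dirac_apply' _ hB]
  refine le_add_right (le_mul_of_one_le_of_le (ENNReal.one_le_ofReal.2 hγ) ?_)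
  by_cases hx : x ∈ A
  · simp [hx, hAB ⟨x, hx, hΦ⟩]
  · simp [hx]

theorem lintegral_eq_setLIntegral_Ioc_meas_lt {F : X → ℝ≥0∞} (hF : Measurable F)
    (hF_le : ∀ x, F x ≤ 1) (μ : Measure X) :
    ∫⁻ x, F x ∂μ = ∫⁻ t in Set.Ioc (0 : ℝ) 1, μ {x | ENNReal.ofReal t < F x} := by
  have hF_top : ∀ x, F x ≠ ∞ := fun x => ((hF_le x).trans_lt ENNReal.one_lt_top).ne
  calc ∫⁻ x, F x ∂μ = ∫⁻ x, ENNReal.ofReal (F x).toReal ∂μ := by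
        simp only [ENNReal.ofReal_toReal (hF_top _)]
    _ = ∫⁻ t in Set.Ioi (0 : ℝ), μ {x | t < (F x).toReal} :=
      lintegral_eq_lintegral_meas_lt μ (ae_of_all _ fun _ => ENNReal.toReal_nonneg)
        hF.ennreal_toReal.aemeasurable
    _ = ∫⁻ t in Set.Ioi (0 : ℝ), μ {x | ENNReal.ofReal t < F x} :=
      setLIntegral_congr_fun measurableSet_Ioi fun t ht => congrArg μ <| Set.ext fun x =>
        (ENNReal.ofReal_lt_iff_lt_toReal (Set.mem_Ioi.1 ht).le (hF_top x)).symm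
    _ = ∫⁻ t in Set.Ioc (0 : ℝ) 1, μ {x | ENNReal.ofReal t < F x} := by
      have hsupp : (fun t : ℝ => μ {x | ENNReal.ofReal t < F x}).support ⊆ Set.Iic 1 := by
        refine Function.support_subset_iff'.2 fun t ht => ?_
        have ht_one : 1 ≤ ENNReal.ofReal t := ENNReal.one_le_ofReal.2 (not_le.1 ht).le
        have hempty : {x | ENNReal.ofReal t < F x} = ∅ :=
          Set.eq_empty_of_forall_notMem fun x hx => ((hF_le x).trans ht_one).not_gt hx
        rw [hempty, measure_empty]
      rw [← setLIntegral_eq_of_support_subset hsupp, Measure.restrict_restrict measurableSet_Iic,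
        Set.Iic_inter_Ioi]

-- Layer-cake: for each level `t`, the lifting compares `{F > t}` with `{G > t}`.
theorem lift.lintegral_le (h : lift γ δ Φ ν₁ ν₂) {F : X → ℝ≥0∞} {G : Y → ℝ≥0∞}
    (hF : Measurable F) (hG : Measurable G) (hF_le : ∀ x, F x ≤ 1)
    (hFG : ∀ x y, Φ x y → F x ≤ G y) :
    ∫⁻ x, F x ∂ν₁.1 ≤ ENNReal.ofReal γ * ∫⁻ y, G y ∂ν₂.1 + ENNReal.ofReal δ := by
  have hG_min : Measurable fun y => min (G y) 1 := hG.min measurable_const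
  calc ∫⁻ x, F x ∂ν₁.1 = ∫⁻ t in Set.Ioc (0 : ℝ) 1, ν₁.1 {x | ENNReal.ofReal t < F x} :=
        lintegral_eq_setLIntegral_Ioc_meas_lt hF hF_le _
    _ ≤ ∫⁻ t in Set.Ioc (0 : ℝ) 1, (ENNReal.ofReal γ *
          ν₂.1 {y | ENNReal.ofReal t < min (G y) 1} + ENNReal.ofReal δ) := by
      refine lintegral_mono fun t => h _ _ (measurableSet_lt measurable_const hF)
        (measurableSet_lt measurable_const hG_min) ?_
      rintro y ⟨x, hx, hxy⟩
      exact hx.trans_le (le_min (hFG x y hxy) (hF_le x))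
    _ = ENNReal.ofReal γ * ∫⁻ y, min (G y) 1 ∂ν₂.1 + ENNReal.ofReal δ := by
      rw [lintegral_add_right _ measurable_const, lintegral_const_mul' _ _ ENNReal.ofReal_ne_top,
        ← lintegral_eq_setLIntegral_Ioc_meas_lt hG_min fun _ => min_le_right _ _]
      simp
    _ ≤ _ := by gcongr; exact min_le_left _ _

theorem lift_comp {Z Z' : Type} [MeasurableSpace Z] [MeasurableSpace Z'] {Θ : Z → Z' → Prop}
    (hδ : 0 ≤ δ) (hδ' : 0 ≤ δ') {f : SRel X Y} {f' : SRel X' Y'} {g : SRel Y Z} {g' : SRel Y' Z'}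
    {Φ : Y → Y' → Prop} {x : X} {x' : X'} (hf : lift γ δ Φ (f.toFun x) (f'.toFun x'))
    (hg : ∀ y y', Φ y y' → lift γ' δ' Θ (g.toFun y) (g'.toFun y')) :
    lift (γ * γ') (δ + δ') Θ ((g.comp f).toFun x) ((g'.comp f').toFun x') := by
  intro A B hA hB hAB
  have hgA : Measurable fun y => g.1 y A := Kernel.measurable_coe _ hA
  have hgB : Measurable fun y => g'.1 y B := Kernel.measurable_coe _ hB
  have hγ_mul : ENNReal.ofReal γ * ENNReal.ofReal γ' ≤ ENNReal.ofReal (γ * γ') := by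
    rcases le_total 0 γ with hγ | hγ
    · rw [ENNReal.ofReal_mul hγ]
    · simp [ENNReal.ofReal_of_nonpos hγ]
  -- Truncating `g y A - δ'` keeps the two error terms additive, without a factor `γ` on `δ'`.
  have htrunc : ∫⁻ y, (g.1 y A - ENNReal.ofReal δ') ∂f.1 x ≤
      ENNReal.ofReal γ * ∫⁻ y, ENNReal.ofReal γ' * g'.1 y B ∂f'.1 x' + ENNReal.ofReal δ :=
    hf.lintegral_le (hgA.sub_const _) (hgB.const_mul _)
      (fun y => tsub_le_self.trans ((measure_mono (Set.subset_univ A)).trans (g.2 y)))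
      fun y y' hyy' => tsub_le_iff_right.2 (hg y y' hyy' A B hA hB hAB)
  change (g.1 ∘ₖ f.1) x A ≤ ENNReal.ofReal (γ * γ') * (g'.1 ∘ₖ f'.1) x' B + _
  rw [Kernel.comp_apply' _ _ _ hA, Kernel.comp_apply' _ _ _ hB]
  calc ∫⁻ y, g.1 y A ∂f.1 x
      ≤ ∫⁻ y, ((g.1 y A - ENNReal.ofReal δ') + ENNReal.ofReal δ') ∂f.1 x :=
        lintegral_mono fun y => le_tsub_add
    _ ≤ ∫⁻ y, (g.1 y A - ENNReal.ofReal δ') ∂f.1 x + ENNReal.ofReal δ' := by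
      rw [lintegral_add_right _ measurable_const, lintegral_const]
      gcongr
      exact mul_le_of_le_one_right' (f.2 x)
    _ ≤ ENNReal.ofReal γ * (ENNReal.ofReal γ' * ∫⁻ y, g'.1 y B ∂f'.1 x') + ENNReal.ofReal δ +
          ENNReal.ofReal δ' := by
      rw [← lintegral_const_mul _ hgB]
      gcongr
    _ ≤ ENNReal.ofReal (γ * γ') * ∫⁻ y, g'.1 y B ∂f'.1 x' + ENNReal.ofReal (δ + δ') := by
      rw [← mul_assoc, add_assoc, ENNReal.ofReal_add hδ hδ']
      gcongr

theorem lift_sup {f : ℕ → SRel X Y} {f' : ℕ → SRel X' Y'} (hf : Monotone f) (hf' : Monotone f')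
    {Φ : Y → Y' → Prop} {x : X} {x' : X'}
    (h : ∀ n, lift γ δ Φ ((f n).toFun x) ((f' n).toFun x')) :
    lift γ δ Φ ((SRel.sup f hf).toFun x) ((SRel.sup f' hf').toFun x') := by
  intro A B hA hB hAB
  change SRel.supMeasure f hf x A ≤ _ * SRel.supMeasure f' hf' x' B + _
  rw [SRel.supMeasure_apply f hf x hA, SRel.supMeasure_apply f' hf' x' hB]
  refine iSup_le fun n => (h n A B hA hB hAB).trans ?_
  gcongr
  exact le_iSup (fun n => (f' n).1 x' B) n

theorem lift_eq_of_forall {ι : Type*} [Countable ι] [MeasurableSpace ι]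
    [MeasurableSingletonClass ι] {f : X → ι} {g : Y → ι} (hf : Measurable f) (hg : Measurable g)
    {δ : ι → ℝ} (hδ : ∀ i, 0 ≤ δ i) (hsum : HasSum δ δ')
    (h : ∀ i, lift γ (δ i) (fun x y => f x = i → g y = i) ν₁ ν₂) :
    lift γ δ' (fun x y => f x = g y) ν₁ ν₂ := by
  intro A B _ _ hAB
  have hfiber : ∀ i, ν₁.1 (f ⁻¹' {i}) ≤
      ENNReal.ofReal γ * ν₂.1 (g ⁻¹' {i}) + ENNReal.ofReal (δ i) := fun i => by
    refine h i _ _ (hf (measurableSet_singleton i)) (hg (measurableSet_singleton i)) ?_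
    rintro y ⟨x, hx, hxy⟩
    exact hxy hx
  have hsub : g ⁻¹' (f '' A) ⊆ B := by
    rintro y ⟨x, hx, hxy⟩
    exact hAB ⟨x, hx, hxy⟩
  have hcount : (f '' A).Countable := Set.to_countable _
  calc ν₁.1 A ≤ ν₁.1 (f ⁻¹' (f '' A)) := measure_mono (Set.subset_preimage_image f A)
    _ = ∑' i : f '' A, ν₁.1 (f ⁻¹' {(i : ι)}) :=
      (tsum_measure_preimage_singleton hcount fun i _ => hf (measurableSet_singleton i)).symm
    _ ≤ ∑' i : f '' A, (ENNReal.ofReal γ * ν₂.1 (g ⁻¹' {(i : ι)}) + ENNReal.ofReal (δ i)) :=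
      ENNReal.tsum_le_tsum fun i => hfiber i
    _ = ENNReal.ofReal γ * ν₂.1 (g ⁻¹' (f '' A)) + ∑' i : f '' A, ENNReal.ofReal (δ i) := by
      rw [ENNReal.tsum_add, ENNReal.tsum_mul_left,
        tsum_measure_preimage_singleton hcount fun i _ => hg (measurableSet_singleton i)]
    _ ≤ ENNReal.ofReal γ * ν₂.1 B + ∑' i, ENNReal.ofReal (δ i) := by
      gcongr
      exact ENNReal.tsum_comp_le_tsum_of_injective Subtype.val_injective
        (fun i => ENNReal.ofReal (δ i))
    _ = _ := by rw [← ENNReal.ofReal_tsum_of_nonneg hδ hsum.summable, hsum.tsum_eq]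

end Lifting

section Loop

variable {X Y : Type} [MeasurableSpace X] [MeasurableSpace Y] {ι : Type*} {γ δ : ι → ℝ}
  {b : X → Bool} {b' : Y → Bool} {c : SRel X X} {c' : SRel Y Y} {I : ι → X → Y → Prop}
  {Φ : X → Y → Prop}

-- `(γ k, δ k)` is the budget left in state `k` of the invariant; a round moves from `k` to some `l`
-- and may spend the difference.
theorem lift_whileApprox (hb : Measurable b) (hb' : Measurable b') (hγ : ∀ k, 1 ≤ γ k)
    (hδ : ∀ k, 0 ≤ δ k) (guard : ∀ k x y, I k x y → b x = b' y)
    (body : ∀ k x y, I k x y → b x = true → ∃ l γ' δ', 0 ≤ δ' ∧ γ' * γ l = γ k ∧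
      δ' + δ l = δ k ∧ lift γ' δ' (I l) (c.toFun x) (c'.toFun y))
    (exit : ∀ k x y, I k x y → b x = false → Φ x y) (n : ℕ) :
    ∀ k x y, I k x y → lift (γ k) (δ k) Φ
      ((SRel.whileApprox b hb c n).toFun x) ((SRel.whileApprox b' hb' c' n).toFun y) := by
  induction n with
  | zero =>
    intro k x y hI
    cases hx : b x with
    | false =>
      exact lift_of_dirac (hγ k) (SRel.whileApprox_apply_of_false hb c 0 hx)
        (SRel.whileApprox_apply_of_false hb' c' 0 ((guard k x y hI).symm.trans hx))
        (exit k x y hI hx)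
    | true =>
      have hzero : (SRel.whileApprox b hb c 0).1 x = 0 := by
        simp [SRel.whileApprox, SRel.cond_apply, hx, SRel.bot]
      intro A B _ _ _
      simp [SRel.toFun, hzero]
  | succ n ih =>
    intro k x y hI
    cases hx : b x with
    | false =>
      exact lift_of_dirac (hγ k) (SRel.whileApprox_apply_of_false hb c _ hx)
        (SRel.whileApprox_apply_of_false hb' c' _ ((guard k x y hI).symm.trans hx))
        (exit k x y hI hx)
    | true =>
      have hy : b' y = true := (guard k x y hI).symm.trans hx
      obtain ⟨l, γ', δ', hδ', hγ_eq, hδ_eq, hbody⟩ := body k x y hI hx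
      have hcomp := lift_comp hδ' (hδ l) hbody (ih l)
      rw [hγ_eq, hδ_eq] at hcomp
      simpa [SRel.toFun, SRel.whileApprox, SRel.cond_apply, hx, hy] using hcomp

theorem lift_loop (hb : Measurable b) (hb' : Measurable b') (hγ : ∀ k, 1 ≤ γ k)
    (hδ : ∀ k, 0 ≤ δ k) (guard : ∀ k x y, I k x y → b x = b' y)
    (body : ∀ k x y, I k x y → b x = true → ∃ l γ' δ', 0 ≤ δ' ∧ γ' * γ l = γ k ∧
      δ' + δ l = δ k ∧ lift γ' δ' (I l) (c.toFun x) (c'.toFun y))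
    (exit : ∀ k x y, I k x y → b x = false → Φ x y) {k : ι} {x : X} {y : Y} (hI : I k x y) :
    lift (γ k) (δ k) Φ ((SRel.loop b hb c).toFun x) ((SRel.loop b' hb' c').toFun y) :=
  lift_sup _ _ fun n => lift_whileApprox hb hb' hγ hδ guard body exit n k x y hI

end Loop

section Laplace

variable {s : ℝ}

theorem lap_apply (s a : ℝ) :
    (lap s).1 a = (∫⁻ b, lapDensity s a b)⁻¹ • volume.withDensity (lapDensity s a) := rfl

theorem lapDensity_add_right (s a b c : ℝ) : lapDensity s (a + c) (b + c) = lapDensity s a b := by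
  simp [lapDensity]

theorem lintegral_lapDensity_eq (s a a' : ℝ) :
    ∫⁻ b, lapDensity s a b = ∫⁻ b, lapDensity s a' b := by
  rw [← lintegral_add_right_eq_self (fun b => lapDensity s a' b) (a' - a)]
  refine lintegral_congr fun b => ?_
  rw [← lapDensity_add_right s a b (a' - a), add_sub_cancel]

theorem lap_map_add_right (s a c : ℝ) : ((lap s).1 a).map (· + c) = (lap s).1 (a + c) := by
  have hdensity : (volume.withDensity (lapDensity s a)).map (· + c) =
      volume.withDensity (lapDensity s (a + c)) := by
    ext B hB
    have hshift := (measurePreserving_add_right volume c).setLIntegral_comp_preimage hB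
      ((measurable_lapDensity s).comp (measurable_prodMk_left (x := a + c)))
    simp only [Function.comp_apply, Function.uncurry_apply_pair, lapDensity_add_right] at hshift
    rw [Measure.map_apply (measurable_add_const c) hB, withDensity_apply _ hB,
      withDensity_apply _ (measurable_add_const c hB), hshift]
  rw [lap_apply, lap_apply, Measure.map_smul, hdensity, lintegral_lapDensity_eq s a (a + c)]

theorem lapDensity_le (hs : 0 < s) {a a' ρ : ℝ} (h : |a - a'| ≤ ρ) (b : ℝ) :
    lapDensity s a b ≤ ENNReal.ofReal (Real.exp (ρ / s)) * lapDensity s a' b := by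
  rw [lapDensity, lapDensity, ← ENNReal.ofReal_mul (Real.exp_pos _).le, mul_left_comm,
    ← Real.exp_add, ← add_div]
  gcongr
  linarith [abs_sub_le b a a']

theorem lap_le_smul (hs : 0 < s) {a a' ρ : ℝ} (h : |a - a'| ≤ ρ) :
    (lap s).1 a ≤ ENNReal.ofReal (Real.exp (ρ / s)) • (lap s).1 a' := by
  have hdensity : volume.withDensity (lapDensity s a) ≤
      ENNReal.ofReal (Real.exp (ρ / s)) • volume.withDensity (lapDensity s a') := by
    rw [← withDensity_smul' _ _ ENNReal.ofReal_ne_top]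
    exact withDensity_mono (ae_of_all _ (lapDensity_le hs h))
  rw [lap_apply, lap_apply, lintegral_lapDensity_eq s a a', smul_comm]
  gcongr

theorem lift_lap (hs : 0 < s) {a a' c ρ : ℝ} (h : |a + c - a'| ≤ ρ) :
    lift (Real.exp (ρ / s)) 0 (fun u v => u + c = v) ((lap s).toFun a) ((lap s).toFun a') := by
  intro A B _ hB hAB
  have hsub : A ⊆ (· + c) ⁻¹' B := fun u hu => hAB ⟨u, hu, rfl⟩
  calc (lap s).1 a A ≤ (lap s).1 a ((· + c) ⁻¹' B) := measure_mono hsub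
    _ = (lap s).1 (a + c) B := by
      rw [← lap_map_add_right, Measure.map_apply (measurable_add_const c) hB]
    _ ≤ ENNReal.ofReal (Real.exp (ρ / s)) * (lap s).1 a' B := lap_le_smul hs h B
    _ = _ := by rw [ENNReal.ofReal_zero, add_zero]; rfl

end Laplace

section Semantics

variable {V : Type} {Γ : V → Ty} {τ τ' : Ty}

instance Ty.instMeasurableSingletonClass : (τ : Ty) → MeasurableSingletonClass τ.interp
  | .bool => (inferInstance : MeasurableSingletonClass Bool)
  | .int => (inferInstance : MeasurableSingletonClass ℤ)
  | .real => (inferInstance : MeasurableSingletonClass ℝ)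
  | .data N => (inferInstance : MeasurableSingletonClass (Fin N → ℝ))

theorem PExpr.eval_lap (s : ℝ) (e : Expr Γ Ty.real) (m : Mem Γ) :
    (PExpr.lap s e).eval.1 m = (ApRHL.lap s).1 (e.eval m) := by
  refine (SRel.comp_apply_of_dirac _ _ (SRel.pure_apply _ _ m)).trans ?_
  exact SRel.comp_apply_of_dirac _ _ (SRel.pure_apply _ _ _)

theorem Expr.eval_congr (e : Expr Γ τ) {m m' : Mem Γ} (h : ∀ x ∈ e.FV, m x = m' x) :
    e.eval m = e.eval m' := by
  induction e with
  | var x =>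
    have hx := h x.1 rfl
    simp only [Expr.eval, Var.get, hx]
  | op p args ih =>
    exact congrArg p.1 (funext fun i => ih i fun x hx => h x (Set.mem_iUnion.2 ⟨i, hx⟩))

variable [DecidableEq V]

theorem Var.get_set_self (x : Var Γ τ) (v : τ.interp) (m : Mem Γ) : x.get (x.set (v, m)) = v := by
  obtain ⟨x, rfl⟩ := x
  simp [Var.get, Var.set]

theorem Expr.eval_set_of_notMem (e : Expr Γ τ) (x : Var Γ τ') (hx : x.1 ∉ e.FV) (v : τ'.interp)
    (m : Mem Γ) : e.eval (x.set (v, m)) = e.eval m :=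
  e.eval_congr fun y hy => by
    have hyx : y ≠ x.1 := fun h => hx (h ▸ hy)
    simp [Var.set, hyx]

theorem SRel.draw_apply (x : Var Γ τ) (ν : SRel (Mem Γ) τ.interp) (m : Mem Γ) :
    (SRel.draw x ν).1 m = (ν.1 m).map fun v => x.set (v, m) := by
  change ((ν.1 ×ₖ Kernel.id).map x.set) m = _
  rw [Kernel.map_apply _ x.measurable_set, Kernel.prod_apply, Kernel.id_apply,
    Measure.prod_dirac, Measure.map_map x.measurable_set measurable_prodMk_right]
  rfl

theorem Imp.interp_cmd (i : Imp Γ) : i.cmd.interp = i.interp := SRel.unit_comp _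

theorem Imp.interp_sample_lap (x : Var Γ Ty.real) (s : ℝ) (e : Expr Γ Ty.real) (m : Mem Γ) :
    (Imp.sample x (.lap s e)).interp.1 m =
      ((ApRHL.lap s).1 (e.eval m)).map fun v => x.set (v, m) := by
  rw [Imp.interp, SRel.draw_apply, PExpr.eval_lap]

theorem Imp.interp_assign (x : Var Γ τ) (e : Expr Γ τ) (m : Mem Γ) :
    (Imp.assign x e).interp.1 m = Measure.dirac (x.set (e.eval m, m)) :=
  SRel.pure_apply _ _ m

theorem Imp.interp_ite_of_true {b : Expr Γ Ty.bool} {c₁ c₂ : Cmd Γ} {m : Mem Γ}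
    (hb : b.eval m = true) : (Imp.ite b c₁ c₂).interp.1 m = c₁.interp.1 m :=
  if_pos hb

theorem Imp.interp_ite_of_false {b : Expr Γ Ty.bool} {c₁ c₂ : Cmd Γ} {m : Mem Γ}
    (hb : b.eval m = false) : (Imp.ite b c₁ c₂).interp.1 m = c₂.interp.1 m :=
  if_neg (ne_true_of_eq_false hb)

theorem Cmd.interp_skip (m : Mem Γ) : (Cmd.skip : Cmd Γ).interp.1 m = Measure.dirac m :=
  SRel.pure_apply _ _ m

theorem Cmd.interp_seq_of_dirac {i : Imp Γ} {c : Cmd Γ} {m n : Mem Γ}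
    (hi : i.interp.1 m = Measure.dirac n) : (Cmd.seq i c).interp.1 m = c.interp.1 n :=
  SRel.comp_apply_of_dirac _ _ hi

theorem Cmd.interp_assign_skip (x : Var Γ τ) (e : Expr Γ τ) (m : Mem Γ) :
    (Cmd.seq (.assign x e) .skip).interp.1 m = Measure.dirac (x.set (e.eval m, m)) :=
  (Cmd.interp_seq_of_dirac (Imp.interp_assign x e m)).trans (Cmd.interp_skip _)

end Semantics

section Rules

variable {V : Type} [DecidableEq V] {Γ : V → Ty} {c c₁ c₂ : Cmd Γ} {γ δ : ℝ}
  {Ψ Ψ' Φ : Mem Γ → Mem Γ → Prop}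

theorem valid_iff : Valid c₁ c₂ γ δ Ψ Φ ↔ OneSidedValid c₁ c₂ γ δ Ψ Φ ∧
    OneSidedValid c₂ c₁ γ δ (fun m₂ m₁ => Ψ m₁ m₂) (fun m₂ m₁ => Φ m₁ m₂) :=
  ⟨fun ⟨h₁, h₂, h⟩ => ⟨⟨h₁, h₂, fun x y hxy => (h x y hxy).1⟩,
      ⟨h₂, h₁, fun y x hxy => (h x y hxy).2⟩⟩,
    fun ⟨⟨h₁, h₂, h⟩, ⟨_, _, h'⟩⟩ => ⟨h₁, h₂, fun x y hxy => ⟨h x y hxy, h' y x hxy⟩⟩⟩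

theorem Valid.of_symm (hΨ : ∀ m₁ m₂, Ψ m₁ m₂ → Ψ m₂ m₁)
    (hΦ : ∀ m₁ m₂, Φ m₁ m₂ → Φ m₂ m₁) (h : OneSidedValid c c γ δ Ψ Φ) : Valid c c γ δ Ψ Φ := by
  have hΨ_swap : (fun m₂ m₁ => Ψ m₁ m₂) = Ψ := by ext m₁ m₂; exact ⟨hΨ _ _, hΨ _ _⟩
  have hΦ_swap : (fun m₂ m₁ => Φ m₁ m₂) = Φ := by ext m₁ m₂; exact ⟨hΦ _ _, hΦ _ _⟩
  exact valid_iff.2 ⟨h, by rwa [hΨ_swap, hΦ_swap]⟩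

theorem Valid.mono_pre (h : Valid c₁ c₂ γ δ Ψ Φ) (hΨ : ∀ m₁ m₂, Ψ' m₁ m₂ → Ψ m₁ m₂) :
    Valid c₁ c₂ γ δ Ψ' Φ :=
  ⟨h.1, h.2.1, fun m₁ m₂ hm => h.2.2 m₁ m₂ (hΨ m₁ m₂ hm)⟩

theorem OneSidedValid.forallEq {τ : Ty} [Countable τ.interp] {x : Var Γ τ} {δ : τ.interp → ℝ}
    {δ' : ℝ} (hδ : ∀ i, 0 ≤ δ i) (hsum : HasSum δ δ')
    (h : ∀ i, OneSidedValid c₁ c₂ γ (δ i) Ψ fun m₁ m₂ => x.get m₁ = i → x.get m₂ = i) :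
    OneSidedValid c₁ c₂ γ δ' Ψ fun m₁ m₂ => x.get m₁ = x.get m₂ :=
  ⟨SRel.measurable_toFun _, SRel.measurable_toFun _, fun m₁ m₂ hm =>
    lift_eq_of_forall x.measurable_get x.measurable_get hδ hsum fun i => (h i).2.2 m₁ m₂ hm⟩

theorem Valid.forallEq {τ : Ty} [Countable τ.interp] {x : Var Γ τ} {δ : τ.interp → ℝ} {δ' : ℝ}
    (hδ : ∀ i, 0 ≤ δ i) (hsum : HasSum δ δ')
    (h : ∀ i, Valid c₁ c₂ γ (δ i) Ψ fun m₁ m₂ => x.get m₁ = i → x.get m₂ = i)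
    (h' : ∀ i, Valid c₂ c₁ γ (δ i) (fun m₂ m₁ => Ψ m₁ m₂)
      fun m₂ m₁ => x.get m₂ = i → x.get m₁ = i) :
    Valid c₁ c₂ γ δ' Ψ fun m₁ m₂ => x.get m₁ = x.get m₂ := by
  refine valid_iff.2 ⟨.forallEq hδ hsum fun i => (valid_iff.1 (h i)).1, ?_⟩
  simpa only [eq_comm] using
    OneSidedValid.forallEq hδ hsum fun i => (valid_iff.1 (h' i)).1

theorem lift_sample_lap {x y : Var Γ Ty.real} {e₁ e₂ : Expr Γ Ty.real} {s ρ c : ℝ} (hs : 0 < s)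
    {m₁ m₂ : Mem Γ} (h : |e₁.eval m₁ + c - e₂.eval m₂| ≤ ρ)
    (hΦ : ∀ v : ℝ, Φ (x.set (v, m₁)) (y.set (v + c, m₂))) :
    lift (Real.exp (ρ / s)) 0 Φ ((Imp.sample x (.lap s e₁)).interp.toFun m₁)
      ((Imp.sample y (.lap s e₂)).interp.toFun m₂) := by
  refine (lift_lap hs h).map (x.measurable_set.comp measurable_prodMk_right)
    (y.measurable_set.comp measurable_prodMk_right) (Imp.interp_sample_lap x s e₁ m₁)
    (Imp.interp_sample_lap y s e₂ m₂) ?_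
  rintro u _ rfl
  exact hΦ u

theorem Valid.sample_lap {x y : Var Γ Ty.real} {e₁ e₂ : Expr Γ Ty.real} {s ρ : ℝ} (hs : 0 < s)
    (h : ∀ m₁ m₂, Ψ m₁ m₂ → ∃ c : ℝ, |e₁.eval m₁ + c - e₂.eval m₂| ≤ ρ ∧
      ∀ v : ℝ, Φ (x.set (v, m₁)) (y.set (v + c, m₂))) :
    Valid (Imp.sample x (.lap s e₁)).cmd (Imp.sample y (.lap s e₂)).cmd
      (Real.exp (ρ / s)) 0 Ψ Φ := by
  refine ⟨SRel.measurable_toFun _, SRel.measurable_toFun _, fun m₁ m₂ hm => ?_⟩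
  obtain ⟨c, hc, hΦ⟩ := h m₁ m₂ hm
  rw [Imp.interp_cmd, Imp.interp_cmd]
  refine ⟨lift_sample_lap hs hc hΦ, lift_sample_lap (c := -c) hs ?_ fun v => ?_⟩
  · have hneg : e₂.eval m₂ + -c - e₁.eval m₁ = -(e₁.eval m₁ + c - e₂.eval m₂) := by ring
    rwa [hneg, abs_neg]
  · simpa using hΦ (v + -c)

theorem Valid.lapGen {x y : Var Γ Ty.real} {e₁ e₂ : Expr Γ Ty.real} {s ρ ρ' : ℝ} (hs : 0 < s)
    (h : ∀ m₁ m₂, Ψ m₁ m₂ → |e₁.eval m₁ + ρ' - e₂.eval m₂| ≤ ρ) :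
    Valid (Imp.sample x (.lap s e₁)).cmd (Imp.sample y (.lap s e₂)).cmd (Real.exp (ρ / s)) 0 Ψ
      fun m₁ m₂ => x.get m₁ + ρ' = y.get m₂ :=
  .sample_lap hs fun m₁ m₂ hm => ⟨ρ', h m₁ m₂ hm, fun v =>
    (congrArg (· + ρ') (x.get_set_self v m₁)).trans (y.get_set_self (v + ρ') m₂).symm⟩

theorem Valid.lapNull {x y : Var Γ Ty.real} {e₁ e₂ : Expr Γ Ty.real} {s : ℝ} (hs : 0 < s)
    (hx : x.1 ∉ e₁.FV) (hy : y.1 ∉ e₂.FV) :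
    Valid (Imp.sample x (.lap s e₁)).cmd (Imp.sample y (.lap s e₂)).cmd 1 0 Ψ
      fun m₁ m₂ => x.get m₁ - y.get m₂ = e₁.eval m₁ - e₂.eval m₂ := by
  have h : Valid (Imp.sample x (.lap s e₁)).cmd (Imp.sample y (.lap s e₂)).cmd
      (Real.exp (0 / s)) 0 Ψ fun m₁ m₂ => x.get m₁ - y.get m₂ = e₁.eval m₁ - e₂.eval m₂ := by
    refine .sample_lap hs fun m₁ m₂ _ => ⟨e₂.eval m₂ - e₁.eval m₁, by simp, fun v => ?_⟩
    rw [Var.get_set_self x v m₁, Var.get_set_self y (v + (e₂.eval m₂ - e₁.eval m₁)) m₂,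
      Expr.eval_set_of_notMem _ _ hx, Expr.eval_set_of_notMem _ _ hy]
    ring
  rwa [zero_div, Real.exp_zero] at h

end Rules

namespace Above

variable {N : ℕ}

/-- The value of `j`, the index of the current query. -/
def idx (m : Mem (ctx N)) : ℤ := j.get m

/-- The value of `r`, the reported query index. -/
def res (m : Mem (ctx N)) : ℤ := r.get m

/-- The value of `T`, the noisy threshold. -/
def thr (m : Mem (ctx N)) : ℝ := T.get m

/-- The value of `d`, the database. -/
def db (m : Mem (ctx N)) : Fin N → ℝ := d.get m

/-- The memory after one run of the loop body in which the value `v` is drawn for `S`. -/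
noncomputable def step (size : ℕ) (m : Mem (ctx N)) (v : ℝ) : Mem (ctx N)
  | .j => idx m + 1
  | .r => if thr m ≤ v ∧ res m = size + 1 then idx m else res m
  | .T => thr m
  | .S => v
  | .d => db m

/-- The branch condition `T ≤ S ∧ r = |Q| + 1` of the loop body. -/
noncomputable def crossing (size : ℕ) : Expr (ctx N) Ty.bool :=
  (Expr.leReal (.var T) (.var S)).and
    (Expr.eqInt (.var r) (.add (.const (τ := .int) (size : ℤ)) (.const (τ := .int) (1 : ℤ))))

/-- The deterministic part of the loop body, which follows the sampling of `S`. -/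
noncomputable def bodyTail (size : ℕ) : Cmd (ctx N) :=
  .seq (.ite (crossing size) (.seq (.assign r (.var j)) .skip) .skip) <|
  .seq (.assign j (.add (.var j) (.const (τ := .int) (1 : ℤ)))) .skip

section Step

variable {size : ℕ} (m : Mem (ctx N)) (v : ℝ)

theorem idx_step : idx (step size m v) = idx m + 1 := rfl

theorem res_step : res (step size m v) =
    if thr m ≤ v ∧ res m = size + 1 then idx m else res m := rfl

theorem eval_crossing :
    (crossing size).eval (S.set (v, m)) = decide (thr m ≤ v ∧ res m = size + 1) :=
  (Bool.decide_and _ _).symm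

theorem interp_bodyTail :
    (bodyTail size).interp.1 (S.set (v, m)) = Measure.dirac (step size m v) := by
  by_cases h : thr m ≤ v ∧ res m = size + 1
  · have hcrossing := (eval_crossing m v).trans (decide_eq_true h)
    rw [bodyTail, Cmd.interp_seq_of_dirac ((Imp.interp_ite_of_true hcrossing).trans
      (Cmd.interp_assign_skip _ _ _)), Cmd.interp_assign_skip]
    refine congrArg Measure.dirac (funext fun x => ?_)
    cases x with
    | r => exact (if_pos h).symm
    | _ => rfl
  · have hcrossing := (eval_crossing m v).trans (decide_eq_false h)
    rw [bodyTail, Cmd.interp_seq_of_dirac ((Imp.interp_ite_of_false hcrossing).trans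
      (Cmd.interp_skip _)), Cmd.interp_assign_skip]
    refine congrArg Measure.dirac (funext fun x => ?_)
    cases x with
    | r => exact (if_neg h).symm
    | _ => rfl

end Step

variable {ε t : ℝ} {Q : ℤ} {size : ℕ} {evalQ : ℤ × ℤ × (Fin N → ℝ) → ℝ} {hevalQ : Measurable evalQ}
  {i : ℤ} {m m₁ m₂ : Mem (ctx N)}

theorem lift_body (hε : 0 < ε) {Φ : Mem (ctx N) → Mem (ctx N) → Prop} (c : ℝ) {ρ : ℝ}
    (h : |evalQ (Q, idx m₁, db m₁) + c - evalQ (Q, idx m₂, db m₂)| ≤ ρ)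
    (hΦ : ∀ v, Φ (step size m₁ v) (step size m₂ (v + c))) :
    lift (Real.exp (ρ / (4 / ε))) 0 Φ ((body ε Q size evalQ hevalQ).interp.toFun m₁)
      ((body ε Q size evalQ hevalQ).interp.toFun m₂) := by
  let query : Expr (ctx N) Ty.real := Expr.op₃ (τ₁ := .queries) (τ₂ := .int) (τ₃ := .data N)
    (τ := .real) evalQ hevalQ (.const (τ := .queries) Q) (.var j) (.var d)
  have hsample := lift_sample_lap (x := S) (y := S) (s := 4 / ε) (e₁ := query) (e₂ := query)
    (Φ := fun n₁ n₂ => ∃ v : ℝ, n₁ = S.set (v, m₁) ∧ n₂ = S.set (v + c, m₂))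
    (by positivity) h fun v => ⟨v, rfl, rfl⟩
  have hbody := lift_comp le_rfl le_rfl hsample
    (g := (bodyTail size).interp) (g' := (bodyTail size).interp) (γ' := 1) (Θ := Φ) ?_
  · rwa [mul_one, add_zero] at hbody
  · rintro _ _ ⟨v, rfl, rfl⟩
    exact lift_of_dirac le_rfl (interp_bodyTail m₁ v) (interp_bodyTail m₂ (v + c)) (hΦ v)

/-- No continuation of `m` reports the query `i`. -/
def Missed (size : ℕ) (i : ℤ) (m : Mem (ctx N)) : Prop :=
  res m ≠ i ∧ (res m = size + 1 → i < idx m)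

/-- The invariant of the loop once the outcome of query `i` is determined: the first run misses `i`,
or both runs have reported the same query. -/
def Settled (size : ℕ) (i : ℤ) (m₁ m₂ : Mem (ctx N)) : Prop :=
  idx m₁ = idx m₂ ∧ (Missed size i m₁ ∨ res m₁ = res m₂ ∧ res m₁ ≠ size + 1)

/-- The invariant of the loop while neither run has reported: the threshold of the second run is
one above that of the first, which makes up for the sensitivity of the queries. -/
def Armed (Q : ℤ) (size : ℕ) (evalQ : ℤ × ℤ × (Fin N → ℝ) → ℝ) (m₁ m₂ : Mem (ctx N)) : Prop :=
  idx m₁ = idx m₂ ∧ res m₁ = size + 1 ∧ res m₂ = size + 1 ∧ thr m₁ + 1 = thr m₂ ∧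
    ∀ k, |evalQ (Q, k, db m₁) - evalQ (Q, k, db m₂)| ≤ 1

theorem Missed.step (h : Missed size i m) (hidx : idx m < size) (v : ℝ) :
    Missed size i (step size m v) := by
  simp only [Missed, idx_step, res_step] at h ⊢
  split_ifs <;> omega

theorem Settled.step (h : Settled size i m₁ m₂) (hidx : idx m₁ < size) (v w : ℝ) :
    Settled size i (step size m₁ v) (step size m₂ w) := by
  refine ⟨by rw [idx_step, idx_step, h.1], h.2.imp (fun hmissed => hmissed.step hidx v) ?_⟩
  rintro ⟨hres, hne⟩
  simp only [res_step, hres ▸ hne, hne, and_false, if_false]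
  exact ⟨hres, hne⟩

theorem Armed.settled_step (h : Armed Q size evalQ m₁ m₂) (hidx : idx m₁ < size)
    (v : ℝ) : Settled size (idx m₁) (step size m₁ v) (step size m₂ (v + 1)) := by
  obtain ⟨hidx_eq, hres₁, hres₂, hthr, -⟩ := h
  have hcross : thr m₂ ≤ v + 1 ↔ thr m₁ ≤ v := by rw [← hthr, add_le_add_iff_right]
  refine ⟨by rw [idx_step, idx_step, hidx_eq], ?_⟩
  by_cases hv : thr m₁ ≤ v
  · refine .inr ?_
    simp only [res_step, hres₁, hres₂, hcross, hv, and_self, if_true]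
    exact ⟨hidx_eq, by omega⟩
  · refine .inl ?_
    simp only [Missed, idx_step, res_step, hres₁, hv, false_and, if_false]
    omega

theorem Armed.armed_or_settled_step (h : Armed Q size evalQ m₁ m₂) (hidx : idx m₁ < size)
    (hi : idx m₁ ≠ i) (v : ℝ) {c : ℝ} (hc : c ≤ 1) :
    Armed Q size evalQ (step size m₁ v) (step size m₂ (v + c)) ∨
      Settled size i (step size m₁ v) (step size m₂ (v + c)) := by
  obtain ⟨hidx_eq, hres₁, hres₂, hthr, hsens⟩ := h
  have hidx_step : idx (step size m₁ v) = idx (step size m₂ (v + c)) := by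
    rw [idx_step, idx_step, hidx_eq]
  by_cases hv : thr m₁ ≤ v
  · refine .inr ⟨hidx_step, .inl ?_⟩
    simp only [Missed, idx_step, res_step, hv, hres₁, and_self, if_true]
    omega
  · have hv₂ : ¬thr m₂ ≤ v + c := by linarith
    refine .inl ⟨hidx_step, ?_, ?_, hthr, hsens⟩
    · rw [res_step, if_neg fun h => hv h.1, hres₁]
    · rw [res_step, if_neg fun h => hv₂ h.1, hres₂]


/-- The invariant of the loop, for a fixed query index `i`; `armed` says that query `i` may still
have to be paid for. -/
def Invariant (Q : ℤ) (size : ℕ) (evalQ : ℤ × ℤ × (Fin N → ℝ) → ℝ) (i : ℤ) (armed : Bool)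
    (m₁ m₂ : Mem (ctx N)) : Prop :=
  Settled size i m₁ m₂ ∨ armed = true ∧ Armed Q size evalQ m₁ m₂

theorem Invariant.idx_eq {armed : Bool} (h : Invariant Q size evalQ i armed m₁ m₂) :
    idx m₁ = idx m₂ :=
  h.elim And.left fun h => h.2.1

theorem Invariant.res_eq {armed : Bool} (h : Invariant Q size evalQ i armed m₁ m₂)
    (hi : res m₁ = i) : res m₂ = i := by
  rcases h with ⟨-, hmissed | hres⟩ | ⟨-, -, hres₁, hres₂, -⟩
  · exact absurd hi hmissed.1
  · exact hres.1.symm.trans hi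
  · exact hres₂.trans (hres₁.symm.trans hi)

/-- The factor of the privacy budget that is left for query `i`. -/
noncomputable def budget (ε : ℝ) (armed : Bool) : ℝ := Real.exp (if armed then ε / 2 else 0)

theorem lift_body_aligned (hε : 0 < ε) {Φ : Mem (ctx N) → Mem (ctx N) → Prop}
    (hΦ : ∀ v, Φ (step size m₁ v)
      (step size m₂ (v + (evalQ (Q, idx m₂, db m₂) - evalQ (Q, idx m₁, db m₁))))) :
    lift 1 0 Φ ((body ε Q size evalQ hevalQ).interp.toFun m₁)
      ((body ε Q size evalQ hevalQ).interp.toFun m₂) := by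
  simpa only [zero_div, Real.exp_zero] using
    lift_body hε (ρ := 0) (evalQ (Q, idx m₂, db m₂) - evalQ (Q, idx m₁, db m₁)) (by simp) hΦ

theorem Invariant.lift_body (hε : 0 < ε) {armed : Bool}
    (h : Invariant Q size evalQ i armed m₁ m₂) (hidx : idx m₁ < size) :
    ∃ armed' γ, γ * budget ε armed' = budget ε armed ∧
      lift γ 0 (Invariant Q size evalQ i armed') ((body ε Q size evalQ hevalQ).interp.toFun m₁)
        ((body ε Q size evalQ hevalQ).interp.toFun m₂) := by
  rcases h with hsettled | ⟨rfl, harmed⟩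
  · exact ⟨armed, 1, one_mul _,
      lift_body_aligned hε fun v => .inl (hsettled.step hidx v _)⟩
  have hsens := abs_le.1 (harmed.2.2.2.2 (idx m₁))
  by_cases hi : idx m₁ = i
  · subst hi
    have hshift : |evalQ (Q, idx m₁, db m₁) + 1 - evalQ (Q, idx m₂, db m₂)| ≤ 2 := by
      rw [← harmed.1, abs_le]
      constructor <;> linarith
    have hexp : Real.exp (2 / (4 / ε)) * budget ε false = budget ε true := by
      simp only [budget, if_true, Bool.false_eq_true, if_false, Real.exp_zero, mul_one]
      congr 1
      field_simp
      norm_num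
    exact ⟨false, _, hexp,
      Above.lift_body hε 1 hshift fun v => .inl (harmed.settled_step hidx v)⟩
  · refine ⟨true, 1, one_mul _, lift_body_aligned hε fun v => ?_⟩
    have hshift : evalQ (Q, idx m₂, db m₂) - evalQ (Q, idx m₁, db m₁) ≤ 1 := by
      rw [← harmed.1]
      linarith
    exact (harmed.armed_or_settled_step hidx hi v hshift).symm.imp_right fun h => ⟨rfl, h⟩

/-- The denotation of the while loop of the algorithm. -/
noncomputable def mainLoop (ε : ℝ) (Q : ℤ) (size : ℕ) (evalQ : ℤ × ℤ × (Fin N → ℝ) → ℝ)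
    (hevalQ : Measurable evalQ) : SRel (Mem (ctx N)) (Mem (ctx N)) :=
  SRel.loop (Expr.eval (.ltInt (.var j) (.const (τ := .int) (size : ℤ))))
    (Expr.measurable_eval _) (body ε Q size evalQ hevalQ).interp

theorem lift_mainLoop (hε : 0 < ε) (h : Armed Q size evalQ m₁ m₂) (i : ℤ) :
    lift (Real.exp (ε / 2)) 0 (fun m₁ m₂ => res m₁ = i → res m₂ = i)
      ((mainLoop ε Q size evalQ hevalQ).toFun m₁)
      ((mainLoop ε Q size evalQ hevalQ).toFun m₂) := by
  have hbudget : ∀ armed, 1 ≤ budget ε armed := fun armed =>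
    Real.one_le_exp (by split_ifs <;> positivity)
  refine lift_loop (I := Invariant Q size evalQ i) (γ := budget ε) (δ := fun _ => 0) (k := true)
    _ _ hbudget (fun _ => le_rfl) (fun _ m₁ m₂ hI => ?_) (fun _ m₁ m₂ hI hguard => ?_)
    (fun _ _ _ hI _ => hI.res_eq) (.inr ⟨rfl, h⟩)
  · exact congrArg (fun k : ℤ => decide (k < (size : ℤ))) hI.idx_eq
  · obtain ⟨armed', γ, hγ, hbody⟩ := hI.lift_body hε (of_decide_eq_true hguard)
    exact ⟨armed', γ, 0, le_rfl, hγ, add_zero 0, hbody⟩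

/-- The memory in which the threshold is drawn. -/
noncomputable def init (size : ℕ) (m : Mem (ctx N)) : Mem (ctx N) :=
  r.set ((size : ℤ) + 1, j.set ((1 : ℤ), m))

theorem interp_aboveT (m : Mem (ctx N)) :
    (aboveT ε t Q size evalQ hevalQ).interp.toFun m = ((mainLoop ε Q size evalQ hevalQ).comp
      (Imp.sample T (.lap (2 / ε) (.const (τ := .real) t))).interp).toFun (init size m) := by
  refine Subtype.ext ?_
  change (aboveT ε t Q size evalQ hevalQ).interp.1 m = _
  rw [aboveT, Cmd.interp_seq_of_dirac (Imp.interp_assign _ _ _),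
    Cmd.interp_seq_of_dirac (Imp.interp_assign _ _ _)]
  change ((SRel.unit.comp (mainLoop ε Q size evalQ hevalQ)).comp _).1 _ = _
  rw [SRel.unit_comp]
  rfl

theorem lift_aboveT (hε : 0 < ε)
    (h : ∀ k, |evalQ (Q, k, db m₁) - evalQ (Q, k, db m₂)| ≤ 1) (i : ℤ) :
    lift (Real.exp ε) 0 (fun m₁ m₂ => res m₁ = i → res m₂ = i)
      ((aboveT ε t Q size evalQ hevalQ).interp.toFun m₁)
      ((aboveT ε t Q size evalQ hevalQ).interp.toFun m₂) := by
  rw [interp_aboveT, interp_aboveT]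
  have hshift : |t + 1 - t| ≤ 1 := by simp
  have hsample := lift_sample_lap (x := T) (y := T) (s := 2 / ε) (ρ := 1) (c := 1)
    (e₁ := .const (τ := .real) t) (e₂ := .const (τ := .real) t)
    (m₁ := init size m₁) (m₂ := init size m₂) (Φ := Armed Q size evalQ) (by positivity)
    hshift fun v => ⟨rfl, rfl, rfl, rfl, h⟩
  have hcomp := lift_comp le_rfl le_rfl hsample fun n₁ n₂ hn =>
    lift_mainLoop (hevalQ := hevalQ) hε hn i
  rwa [← Real.exp_add, add_zero, one_div_div, add_halves] at hcomp

theorem valid_aboveT (hε : 0 < ε) :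
    Valid (aboveT ε t Q size evalQ hevalQ) (aboveT ε t Q size evalQ hevalQ) (Real.exp ε) 0
      (fun m₁ m₂ => ∀ k, |evalQ (Q, k, d.get m₁) - evalQ (Q, k, d.get m₂)| ≤ 1)
      fun m₁ m₂ => r.get m₁ = r.get m₂ :=
  .of_symm (fun _ _ h k => (abs_sub_comm _ _).trans_le (h k)) (fun _ _ => Eq.symm) <|
    .forallEq (τ := .int) (fun _ => le_rfl) hasSum_zero fun i =>
      ⟨SRel.measurable_toFun _, SRel.measurable_toFun _, fun _ _ h => lift_aboveT hε h i⟩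
end Above
end ApRHL

open ApRHL ApRHL.Above in
theorem mainTheorem4_general :
    (∀ (N : ℕ) (ε t : ℝ) (Q : ℤ) (size : ℕ) (evalQ : ℤ × ℤ × (Fin N → ℝ) → ℝ)
      (hevalQ : Measurable evalQ), 0 < ε →
      Valid (aboveT ε t Q size evalQ hevalQ) (aboveT ε t Q size evalQ hevalQ) (Real.exp ε) 0
        (fun m₁ m₂ => ∀ i : ℤ, |evalQ (Q, i, d.get m₁) - evalQ (Q, i, d.get m₂)| ≤ 1)
        (fun m₁ m₂ => r.get m₁ = r.get m₂)) ∧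
    (∀ (V : Type) [DecidableEq V] (Γ : V → Ty) (τ : Ty) [Countable τ.interp]
      (c₁ c₂ : Cmd Γ) (x : Var Γ τ) (γ : ℝ) (δ : τ.interp → ℝ) (δ' : ℝ)
      (Ψ : Mem Γ → Mem Γ → Prop), 0 ≤ γ → (∀ i, 0 ≤ δ i) → HasSum δ δ' →
      (∀ i, OneSidedValid c₁ c₂ γ (δ i) Ψ fun m₁ m₂ => x.get m₁ = i → x.get m₂ = i) →
      OneSidedValid c₁ c₂ γ δ' Ψ fun m₁ m₂ => x.get m₁ = x.get m₂) ∧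
    (∀ (V : Type) [DecidableEq V] (Γ : V → Ty) (τ : Ty) [Countable τ.interp]
      (c₁ c₂ : Cmd Γ) (x : Var Γ τ) (γ : ℝ) (δ : τ.interp → ℝ) (δ' : ℝ)
      (Ψ : Mem Γ → Mem Γ → Prop), 0 ≤ γ → (∀ i, 0 ≤ δ i) → HasSum δ δ' →
      (∀ i, Valid c₁ c₂ γ (δ i) Ψ fun m₁ m₂ => x.get m₁ = i → x.get m₂ = i) →
      (∀ i, Valid c₂ c₁ γ (δ i) (fun m₂ m₁ => Ψ m₁ m₂)
        fun m₂ m₁ => x.get m₂ = i → x.get m₁ = i) →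
      Valid c₁ c₂ γ δ' Ψ fun m₁ m₂ => x.get m₁ = x.get m₂) ∧
    (∀ (V : Type) [DecidableEq V] (Γ : V → Ty) (x y : Var Γ Ty.real)
      (e₁ e₂ : Expr Γ Ty.real) (s ρ ρ' : ℝ) (Ψ : Mem Γ → Mem Γ → Prop),
      0 < s → (∀ m₁ m₂, Ψ m₁ m₂ → |e₁.eval m₁ + ρ' - e₂.eval m₂| ≤ ρ) →
      Valid (Imp.sample x (.lap s e₁)).cmd (Imp.sample y (.lap s e₂)).cmd
        (Real.exp (ρ / s)) 0 Ψ fun m₁ m₂ => x.get m₁ + ρ' = y.get m₂) ∧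
    (∀ (V : Type) [DecidableEq V] (Γ : V → Ty) (x y : Var Γ Ty.real)
      (e₁ e₂ : Expr Γ Ty.real) (s : ℝ) (Ψ : Mem Γ → Mem Γ → Prop),
      0 < s → x.1 ∉ e₁.FV → y.1 ∉ e₂.FV →
      Valid (Imp.sample x (.lap s e₁)).cmd (Imp.sample y (.lap s e₂)).cmd 1 0 Ψ
        fun m₁ m₂ => x.get m₁ - y.get m₂ = e₁.eval m₁ - e₂.eval m₂) := by
  refine ⟨?_, ?_, ?_, ?_, ?_⟩
  · exact fun _ _ _ _ _ _ _ hε => valid_aboveT hε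
  · exact fun _ _ _ _ _ _ _ _ _ _ _ _ _ hδ hsum h => .forallEq hδ hsum h
  · exact fun _ _ _ _ _ _ _ _ _ _ _ _ _ hδ hsum h h' => .forallEq hδ hsum h h'
  · exact fun _ _ _ _ _ _ _ _ _ _ _ hs h => .lapGen hs h
  · exact fun _ _ _ _ _ _ _ _ _ hs hx hy => .lapNull hs hx hy

theorem mainTheorem4 :
    (∀ (N : ℕ) (ε t : ℝ) (Q : ℤ) (size : ℕ) (evalQ : ℤ × ℤ × (Fin N → ℝ) → ℝ)
      (hevalQ : Measurable evalQ), 0 < ε →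
      (∀ (i : ℤ) (a b : Fin N → ℝ), ∑ k, |a k - b k| ≤ 1 →
        |evalQ (Q, i, a) - evalQ (Q, i, b)| ≤ 1) →
      ApRHL.Valid (ApRHL.Above.aboveT ε t Q size evalQ hevalQ)
        (ApRHL.Above.aboveT ε t Q size evalQ hevalQ) (Real.exp ε) 0
        (fun m₁ m₂ => ∑ k, |ApRHL.Above.d.get m₁ k - ApRHL.Above.d.get m₂ k| ≤ 1)
        (fun m₁ m₂ => ApRHL.Above.r.get m₁ = ApRHL.Above.r.get m₂)) ∧
    ApRHL.ForallEqOneSidedSound ∧ ApRHL.ForallEqSound ∧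
    ApRHL.LapGenSound ∧ ApRHL.LapNullSound := by
  obtain ⟨haboveT, hforallEq₁, hforallEq, hlapGen, hlapNull⟩ := mainTheorem4_general
  refine ⟨fun N ε t Q size evalQ hevalQ hε hsens =>
    (haboveT N ε t Q size evalQ hevalQ hε).mono_pre fun _ _ h i => hsens i _ _ h, ?_, ?_, ?_, ?_⟩
  · exact fun V _ _ Γ c₁ c₂ x γ δ δ' Ψ hγ =>
      hforallEq₁ V Γ .int c₁ c₂ x γ δ δ' Ψ (zero_le_one.trans hγ)
  · exact fun V _ _ Γ c₁ c₂ x γ δ δ' Ψ hγ =>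
      hforallEq V Γ .int c₁ c₂ x γ δ δ' Ψ (zero_le_one.trans hγ)
  · exact fun V _ _ => hlapGen V
  · exact fun V _ _ => hlapNull V
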